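/- **Setting.** Let $\Sigma=\mathbb{R}^3$. Fix a group $\mathrm{Diff}$ of homeomorphisms of $\Sigma$ (the diffeomorphisms of the chosen smoothness category) and a class of admissible edges (embedded oriented arcs, or loops with a base point, up to orientation-preserving reparametrisation) that is stable under $\mathrm{Diff}$ and under reversal. A graph $\gamma$ is a finite set of admissible edges, considered up to their orientation, any two of which meet at most in end points. Two parts of a graph are unlinked if either one can be kept fixed while the other is moved arbitrarily far away from it by elements of $\mathrm{Diff}$. An unlinked component of $\gamma$ is a non-empty subgraph that is unlinked from the rest of $\gamma$ and does not split into two mutually unlinked non-empty parts; $\Gamma_1$ is the set of graphs with exactly one unlinked component. $[\gamma]$ denotes the $\mathrm{Diff}$-orbit of $\gamma$. Let $\mathscr{H}'_\gamma\subset L^2(\mathrm{SU}(2)^{E(\gamma)},\text{Haar})$ be the closed span of the gauge invariant spin network functions over $\gamma$ with a non-trivial irreducible representation on each edge, where $\mathscr{H}'_\gamma=0$ if $\gamma$ has a trivial two-valent vertex; states over different graphs are orthogonal. Let $\mathrm{Diff}_\gamma$ be the stabiliser of $\gamma$, $\mathrm{TDiff}_\gamma\subset\mathrm{Diff}_\gamma$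 the subgroup preserving each oriented edge, and $\mathrm{GS}_\gamma=\mathrm{Diff}_\gamma/\mathrm{TDiff}_\gamma$. For $\Psi\in\mathscr{H}'_\gamma$, $\Phi\in\mathscr{H}'_{\gamma'}$ put $$(\eta(\Psi),\eta(\Phi))=(\eta(\Psi)|\Phi\rangle=\frac1{|\mathrm{GS}_\gamma|}\sum_{\rho\in\mathrm{Diff}/\mathrm{Diff}_\gamma}\ \sum_{\varphi\in\mathrm{GS}_\gamma}\langle\rho^*\varphi^*\Psi,\Phi\rangle .$$ Let $\mathscr{H}_{\mathrm{diff}}$ be the Hilbert space completion of the span of the averaged states $\eta(\Psi)$ with this inner product, $\eta(\mathscr{H}'_1)$ the closed subspace generated by the $\eta(\Psi)$ with $\Psi\in\mathscr{H}'_\gamma$, $\gamma\in\Gamma_1$, and $\mathfrak{F}=\mathcal{F}_{\mathrm S}[\eta(\mathscr{H}'_1)]$ the symmetric Fock space over it (with $\langle\otimes_l v_l,\otimes_l w_l\rangle=\prod_l\langle v_l,w_l\rangle$ on $n$-fold tensors). For each $c\in\Gamma_1$ choose an orthonormal basis $\{\mathcal{S}_c^I\}_I$ of $\mathscr{H}'_c$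 consisting of spin network functions, such that diffeomorphic graphs $c,\tilde c$ have the same set of labels $I$, and for some $g\in\mathrm{Diff}$ mapping $c$ to $\tilde c$ the state $\mathcal{S}_{c}^I$ is mapped to $\mathcal{S}_{\tilde c}^{I}$ for all $I$. **Lemma (Inner product on $\mathfrak{F}$).** Let $c_1,\dots,c_n$ and $c'_1,\dots,c'_{n'}$ be in $\Gamma_1$, and let $$|f)=\frac1{n!}\sum_{\sigma\in \mathrm{S}_n}\sum_{\{I\}}f_{I_1\dots I_n}\bigotimes_{l=1}^n\big|\eta(\mathcal{S}_{c_{\sigma(l)}}^{I_{\sigma(l)}})\big),\qquad |f')=\frac1{n'!}\sum_{\sigma\in \mathrm{S}_{n'}}\sum_{\{I'\}}f'_{I'_1\dots I'_{n'}}\bigotimes_{l=1}^{n'}\big|\eta(\mathcal{S}_{c'_{\sigma(l)}}^{I'_{\sigma(l)}})\big)$$ with complex coefficients for which these sums over multi-indices converge unconditionally. 1. If $n\ne n'$, or if the multisets $\{[c_1],\dots,[c_n]\}$ and $\{[c'_1],\dots,[c'_{n'}]\}$ differ, then $(f,f')=0$. 2. Otherwise there is a bijection $\tau$ of $\{1,\dots,n\}$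 with $[c'_{\tau(l)}]=[c_l]$ for all $l$, and for every such $\tau$ $$(f,f')=\frac1{|\mathrm{S}_n^p|}\sum_{\pi\in\mathrm{S}_n^p}\frac{|\mathrm{S}_n^p|}{|\mathrm{S}_n|}\sum_{\{I\}}\sum_{\{I'\}}\overline{f_{\pi I}}\,f'_{I'}\prod_{l=1}^n\big(\eta(\mathcal{S}_{c_l}^{I_l}),\eta(\mathcal{S}_{c_l}^{I'_{\tau(l)}})\big),$$ where $\mathrm{S}_n^p\subset\mathrm{S}_n$ is the subgroup of the permutations $\pi$ with $[c_{\pi(l)}]=[c_l]$ for all $l$, $\pi I=(I_{\pi(1)},\dots,I_{\pi(n)})$, and for each $\pi$ the inner sum over $I'$ and then the outer sum over $I$ converge absolutely. In particular, if $c'_l=c_l$ for all $l$, one can take $\tau=\mathrm{id}$. -/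

import Mathlib

open MeasureTheory
open scoped ComplexConjugate

noncomputable section

namespace LQG

/-- The spatial hypersurface `Σ ≃ ℝ³`, with its fiducial flat metric. -/
abbrev Space : Type := EuclideanSpace ℝ (Fin 3)

/-! ### Oriented edges -/

/-- A parametrised edge: an embedded arc, or an embedded loop with a marked base point. -/
structure Curve where
  toMap : C(unitInterval, Space)
  inj : ∀ s t, toMap s = toMap t → s = t ∨ (s = 0 ∧ t = 1) ∨ (s = 1 ∧ t = 0)

/-- Orientation preserving reparametrisation. -/
instance Curve.setoid : Setoid Curve where
  r p q := ∃ θ : unitInterval ≃o unitInterval, ∀ t, q.toMap t = p.toMap (θ t)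
  iseqv :=
    { refl := fun _ => ⟨OrderIso.refl _, fun _ => rfl⟩
      symm := fun {p q} ⟨θ, h⟩ => ⟨θ.symm, fun t => by rw [h, OrderIso.apply_symm_apply]⟩
      trans := fun {p q r} ⟨θ, h⟩ ⟨θ', h'⟩ => ⟨θ'.trans θ, fun t => by rw [h', h]; rfl⟩ }

/-- An oriented edge: a parametrised edge up to orientation preserving reparametrisation. -/
def OEdge : Type := Quotient Curve.setoid

namespace Curve

/-- The same edge run through backwards. -/
def rev (p : Curve) : Curve where
  toMap := p.toMap.comp ⟨unitInterval.symm, unitInterval.continuous_symm⟩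
  inj s t h := by
    rcases p.inj _ _ h with h | ⟨h, h'⟩ | ⟨h, h'⟩
    · exact Or.inl (unitInterval.symm_bijective.1 h)
    · right; right
      exact ⟨by simpa using congrArg unitInterval.symm h,
        by simpa using congrArg unitInterval.symm h'⟩
    · right; left
      exact ⟨by simpa using congrArg unitInterval.symm h,
        by simpa using congrArg unitInterval.symm h'⟩

/-- The image of an edge under a homeomorphism. -/
def map (g : Space ≃ₜ Space) (p : Curve) : Curve where
  toMap := (g : C(Space, Space)).comp p.toMap
  inj s t h := p.inj s t (g.injective h)

end Curve

theorem orderIso_zero (θ : unitInterval ≃o unitInterval) : θ 0 = 0 := θ.map_bot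

theorem orderIso_one (θ : unitInterval ≃o unitInterval) : θ 1 = 1 := θ.map_top

namespace OEdge

def source : OEdge → Space :=
  Quotient.lift (fun p : Curve => p.toMap 0) (by
    rintro p q ⟨θ, h⟩
    simp only [h, orderIso_zero])

def target : OEdge → Space :=
  Quotient.lift (fun p : Curve => p.toMap 1) (by
    rintro p q ⟨θ, h⟩
    simp only [h, orderIso_one])

/-- The set of points of the edge. -/
def support : OEdge → Set Space :=
  Quotient.lift (fun p : Curve => Set.range p.toMap) (by
    rintro p q ⟨θ, h⟩
    have : (q.toMap : unitInterval → Space) = p.toMap ∘ θ := funext h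
    simp only [this, θ.surjective.range_comp])

/-- The edge with the opposite orientation. -/
def rev : OEdge → OEdge :=
  Quotient.map Curve.rev (by
    rintro p q ⟨θ, h⟩
    refine ⟨⟨⟨fun t => unitInterval.symm (θ (unitInterval.symm t)),
      fun t => unitInterval.symm (θ.symm (unitInterval.symm t)), fun t => by simp,
      fun t => by simp⟩, ?_⟩, fun t => ?_⟩
    · intro a b
      simp
    · simp [Curve.rev, h])

instance : MulAction (Space ≃ₜ Space) OEdge where
  smul g := Quotient.map (Curve.map g) (by
    rintro p q ⟨θ, h⟩
    exact ⟨θ, fun t => by simp [Curve.map, h]⟩)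
  one_smul e := by
    induction e using Quotient.inductionOn with
    | h p => rfl
  mul_smul g h e := by
    induction e using Quotient.inductionOn with
    | h p => rfl

theorem smul_rev (g : Space ≃ₜ Space) (e : OEdge) : g • e.rev = (g • e).rev := by
  induction e using Quotient.inductionOn with
  | h p => rfl

theorem source_smul (g : Space ≃ₜ Space) (e : OEdge) : (g • e).source = g e.source := by
  induction e using Quotient.inductionOn with
  | h p => rfl

theorem target_smul (g : Space ≃ₜ Space) (e : OEdge) : (g • e).target = g e.target := by
  induction e using Quotient.inductionOn with
  | h p => rfl

theorem support_smul (g : Space ≃ₜ Space) (e : OEdge) : (g • e).support = g '' e.support := by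
  induction e using Quotient.inductionOn with
  | h p => exact Set.range_comp g p.toMap

theorem rev_rev (e : OEdge) : e.rev.rev = e := by
  induction e using Quotient.inductionOn with
  | h p =>
    refine congrArg (Quotient.mk _) ?_
    have h : p.rev.rev.toMap = p.toMap := by ext1 t; simp [Curve.rev]
    have ext' : ∀ q r : Curve, q.toMap = r.toMap → q = r := by
      rintro ⟨_, _⟩ ⟨_, _⟩ h; cases h; rfl
    exact ext' _ _ h

/-- The reversal has no fixed points, so an unoriented edge is a pair `{e, e.rev}`. -/
theorem rev_ne (e : OEdge) : e.rev ≠ e := by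
  induction e using Quotient.inductionOn with
  | h p =>
    intro h
    obtain ⟨θ, hθ⟩ := Quotient.exact h
    have key : ∀ t : unitInterval, t ≠ 0 → t ≠ 1 → t = unitInterval.symm (θ t) := by
      intro t h0 h1
      rcases p.inj t (unitInterval.symm (θ t)) (hθ t) with h | ⟨h, -⟩ | ⟨h, -⟩
      · exact h
      · exact absurd h h0
      · exact absurd h h1
    let a : unitInterval := ⟨1 / 3, by norm_num, by norm_num⟩
    let b : unitInterval := ⟨2 / 3, by norm_num, by norm_num⟩
    have hab : a < b := Subtype.mk_lt_mk.2 (by norm_num)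
    have ha := congrArg Subtype.val (key a
      (fun h => by simpa [a] using congrArg Subtype.val h)
      (fun h => by have := congrArg Subtype.val h; norm_num [a] at this))
    have hb := congrArg Subtype.val (key b
      (fun h => by simpa [b] using congrArg Subtype.val h)
      (fun h => by have := congrArg Subtype.val h; norm_num [b] at this))
    have hθ' : ((θ a : unitInterval) : ℝ) < θ b := θ.strictMono hab
    simp only [unitInterval.coe_symm_eq, a, b] at ha hb hθ'
    linarith

/-- `e` is the concatenation of `e₁` with `e₂`. -/
def IsConcat (e e₁ e₂ : OEdge) : Prop :=
  ∃ p p₁ p₂ : Curve, (⟦p⟧ : OEdge) = e ∧ (⟦p₁⟧ : OEdge) = e₁ ∧ (⟦p₂⟧ : OEdge) = e₂ ∧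
    ∀ t s : unitInterval, ((s : ℝ) = t / 2 → p.toMap s = p₁.toMap t) ∧
      ((s : ℝ) = (t + 1) / 2 → p.toMap s = p₂.toMap t)

end OEdge

/-! ### The structure group -/

/-- The group `SU(2)`. -/
abbrev SU2 : Type := Matrix.specialUnitaryGroup (Fin 2) ℂ

instance : MeasurableSpace SU2 := borel SU2

instance : BorelSpace SU2 := ⟨rfl⟩

instance : IsTopologicalGroup SU2 where
  continuous_inv := by
    refine Continuous.subtype_mk (f := fun A : SU2 => star (A : Matrix (Fin 2) (Fin 2) ℂ)) ?_ _
    exact continuous_subtype_val.star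

instance : SecondCountableTopology SU2 :=
  haveI : SecondCountableTopology (Matrix (Fin 2) (Fin 2) ℂ) :=
    inferInstanceAs (SecondCountableTopology (Fin 2 → Fin 2 → ℂ))
  TopologicalSpace.Subtype.secondCountableTopology _

instance : CompactSpace SU2 := by
  have hcl : IsClosed ((Matrix.specialUnitaryGroup (Fin 2) ℂ : Set (Matrix (Fin 2) (Fin 2) ℂ))) := by
    have : (Matrix.specialUnitaryGroup (Fin 2) ℂ : Set (Matrix (Fin 2) (Fin 2) ℂ)) =
        {A | star A * A = 1} ∩ {A | A * star A = 1} ∩ {A | A.det = 1} := by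
      ext A
      simp [Matrix.mem_specialUnitaryGroup_iff, Matrix.unitaryGroup, Unitary.mem_iff]
    rw [this]
    refine ((isClosed_eq ?_ ?_).inter (isClosed_eq ?_ ?_)).inter (isClosed_eq ?_ ?_)
    · exact continuous_star.mul continuous_id
    · exact continuous_const
    · exact continuous_id.mul continuous_star
    · exact continuous_const
    · exact Continuous.matrix_det continuous_id
    · exact continuous_const
  have hK : IsCompact (Set.univ.pi fun _ : Fin 2 => Set.univ.pi fun _ : Fin 2 =>
      Metric.closedBall (0 : ℂ) 1) :=
    isCompact_univ_pi fun _ => isCompact_univ_pi fun _ => isCompact_closedBall _ _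
  refine isCompact_iff_compactSpace.1 (IsCompact.of_isClosed_subset hK hcl ?_)
  intro A hA i _ j _
  simpa using entry_norm_bound_of_unitary (Matrix.mem_specialUnitaryGroup_iff.1 hA).1 i j

/-- The normalised Haar measure on `SU(2)`. -/
def haarSU2 : Measure SU2 := Measure.haarMeasure ⊤

instance : IsProbabilityMeasure haarSU2 :=
  ⟨Measure.haarMeasure_self (K₀ := (⊤ : TopologicalSpace.PositiveCompacts SU2))⟩

/-! ### Graphs -/

/-- A category of smoothness: a group of diffeomorphisms of `Σ` and a class of admissible edges
which is stable under these diffeomorphisms and under reversal of orientation. (For instance the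
analytic, semianalytic, stratified or smooth diffeomorphisms and edges.) -/
structure SmoothCategory where
  Diff : Subgroup (Space ≃ₜ Space)
  Edge : Set OEdge
  rev_mem : ∀ e ∈ Edge, e.rev ∈ Edge
  smul_mem : ∀ g ∈ Diff, ∀ e ∈ Edge, g • e ∈ Edge

/-- A graph: a finite set of edges, taken with both orientations, any two of which
meet at most in end points. -/
@[ext]
structure Graph (C : SmoothCategory) where
  edges : Finset OEdge
  admissible : ∀ e ∈ edges, e ∈ C.Edge
  rev_mem : ∀ e ∈ edges, e.rev ∈ edges
  inter : ∀ e ∈ edges, ∀ e' ∈ edges, e' ≠ e → e' ≠ e.rev →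
    e.support ∩ e'.support ⊆ {e.source, e.target} ∩ {e'.source, e'.target}

variable {C : SmoothCategory}

/-- The union of the given edges as a set of points. -/
def pointSet (E : Set OEdge) : Set Space := ⋃ e ∈ E, e.support

namespace Graph

/-- The image of a graph under a diffeomorphism. -/
instance : MulAction C.Diff (Graph C) where
  smul g γ :=
    { edges := γ.edges.map ⟨fun e => (g : Space ≃ₜ Space) • e, MulAction.injective _⟩
      admissible := by
        intro e he
        obtain ⟨a, ha, rfl⟩ := Finset.mem_map.1 he
        exact C.smul_mem _ g.2 _ (γ.admissible a ha)
      rev_mem := by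
        intro e he
        obtain ⟨a, ha, rfl⟩ := Finset.mem_map.1 he
        exact Finset.mem_map.2 ⟨a.rev, γ.rev_mem a ha, OEdge.smul_rev _ _⟩
      inter := by
        intro e he e' he' h h'
        obtain ⟨a, ha, rfl⟩ := Finset.mem_map.1 he
        obtain ⟨a', ha', rfl⟩ := Finset.mem_map.1 he'
        have := γ.inter a ha a' ha' (fun hh => h (by rw [hh])) (fun hh => h' (by
          simp only [Function.Embedding.coeFn_mk, hh, OEdge.smul_rev]))
        simp only [Function.Embedding.coeFn_mk, OEdge.support_smul, OEdge.source_smul,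
          OEdge.target_smul]
        rw [← Set.image_inter (g : Space ≃ₜ Space).injective]
        rintro _ ⟨x, hx, rfl⟩
        have hx' := this hx
        simp only [Set.mem_inter_iff, Set.mem_insert_iff, Set.mem_singleton_iff] at hx' ⊢
        exact ⟨hx'.1.imp (congrArg _) (congrArg _), hx'.2.imp (congrArg _) (congrArg _)⟩ }
  one_smul γ := by
    refine Graph.ext (Finset.ext fun e => ?_)
    change e ∈ γ.edges.map _ ↔ _
    simp
  mul_smul g h γ := by
    refine Graph.ext (Finset.ext fun e => ?_)
    change e ∈ γ.edges.map _ ↔ e ∈ (γ.edges.map _).map _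
    simp [mul_smul]

theorem mem_smul_edges {g : C.Diff} {γ : Graph C} {e : OEdge} :
    e ∈ (g • γ).edges ↔ ∃ a ∈ γ.edges, (g : Space ≃ₜ Space) • a = e := by
  change e ∈ γ.edges.map _ ↔ _
  simp

theorem smul_mem_of_smul_eq {g : C.Diff} {γ γ' : Graph C} (h : g • γ = γ') {e : OEdge}
    (he : e ∈ γ.edges) : (g : Space ≃ₜ Space) • e ∈ γ'.edges :=
  h ▸ mem_smul_edges.2 ⟨e, he, rfl⟩

/-- Two sets of points are unlinked (with respect to the given diffeomorphisms) if either of them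
can be kept fixed while the other one is moved arbitrarily far away from it. -/
def Unlinked (C : SmoothCategory) (A B : Set Space) : Prop :=
  (∀ R : ℝ, ∃ φ ∈ C.Diff, (∀ x ∈ A, φ x = x) ∧ ∀ x ∈ A, ∀ y ∈ B, R ≤ dist x (φ y)) ∧
  (∀ R : ℝ, ∃ φ ∈ C.Diff, (∀ y ∈ B, φ y = y) ∧ ∀ y ∈ B, ∀ x ∈ A, R ≤ dist y (φ x))

/-- The set of unlinked components of `γ`: the non-empty subgraphs which are not linked with
the rest of `γ`, and which do not themselves decompose into mutually unlinked parts. -/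
def Comp (γ : Graph C) : Set (Graph C) :=
  {c | c.edges ⊆ γ.edges ∧ c.edges.Nonempty ∧
    Unlinked C (pointSet c.edges) (pointSet (γ.edges \ c.edges : Set OEdge)) ∧
    ∀ d : Graph C, d.edges ⊂ c.edges → d.edges.Nonempty →
      ¬ Unlinked C (pointSet d.edges) (pointSet (c.edges \ d.edges : Set OEdge))}

/-- The graphs with `n` unlinked components. -/
def withComponents (C : SmoothCategory) (n : ℕ) : Set (Graph C) :=
  {γ | γ.Comp.encard = n}

/-- `v` is a trivial two-valent vertex of `γ`: exactly two different edges meet at `v`, and they can be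
joined to a single edge, so that `v` can be removed. (The marked point of an isolated loop cannot be
removed in this way. Moving it along the loop does not change the averaged states.) -/
def IsTrivialVertex (γ : Graph C) (v : Space) : Prop :=
  ∃ e₁ ∈ γ.edges, ∃ e₂ ∈ γ.edges, e₁.target = v ∧ e₂.source = v ∧ e₁ ≠ e₂ ∧ e₁ ≠ e₂.rev ∧
    (∀ e ∈ γ.edges, e.source = v → e = e₁.rev ∨ e = e₂) ∧ ∃ e ∈ C.Edge, OEdge.IsConcat e e₁ e₂

/-- The diffeomorphisms which map `γ` onto itself. -/
def Diff (γ : Graph C) : Subgroup C.Diff := MulAction.stabilizer C.Diff γ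

/-- The trivial diffeomorphisms of `γ`: those which preserve each edge with its orientation. -/
def TDiff (γ : Graph C) : Subgroup γ.Diff where
  carrier := {g | ∀ e ∈ γ.edges, ((g : C.Diff) : Space ≃ₜ Space) • e = e}
  one_mem' := fun e _ => one_smul _ e
  mul_mem' := by
    intro g h hg hh e he
    change (((g : C.Diff) : Space ≃ₜ Space) * ((h : C.Diff) : Space ≃ₜ Space)) • e = e
    rw [mul_smul, hh e he, hg e he]
  inv_mem' := by
    intro g hg e he
    change (((g : C.Diff) : Space ≃ₜ Space))⁻¹ • e = e
    rw [inv_smul_eq_iff, hg e he]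

/-- The graph symmetries `GS_γ = Diff_γ / TDiff_γ`. -/
abbrev GS (γ : Graph C) : Type := γ.Diff ⧸ γ.TDiff

/-! ### Cylindrical functions -/

/-- The holonomies of connections along the edges of `γ`. -/
def Conn (γ : Graph C) : Type :=
  {A : γ.edges → SU2 // ∀ e, A ⟨e.1.rev, γ.rev_mem _ e.2⟩ = (A e)⁻¹}

instance (γ : Graph C) : MeasurableSpace γ.Conn := inferInstanceAs (MeasurableSpace (Subtype _))

/-- Holonomies from arbitrary group elements, one for each oriented edge. -/
def toConn (γ : Graph C) (a : γ.edges → SU2) : γ.Conn :=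
  ⟨fun e => a e * (a ⟨e.1.rev, γ.rev_mem _ e.2⟩)⁻¹, fun e => by
    have : (⟨e.1.rev.rev, γ.rev_mem _ (γ.rev_mem _ e.2)⟩ : γ.edges) = e :=
      Subtype.ext (OEdge.rev_rev _)
    simp [this]⟩

/-- The Ashtekar-Lewandowski measure over `γ`: the holonomies along the unoriented edges are
independent and distributed according to the Haar measure. It is obtained as an image of
the product of Haar measures over all oriented edges, which avoids a choice of orientations: if
`a` and `b` are independent and Haar distributed, then so is `a * b⁻¹`. -/
def measure (γ : Graph C) : Measure γ.Conn :=
  (Measure.pi fun _ : γ.edges => haarSU2).map γ.toConn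

theorem measurable_toConn (γ : Graph C) : Measurable γ.toConn := by
  refine Measurable.subtype_mk (measurable_pi_lambda _ fun e => ?_)
  exact (measurable_pi_apply _).mul (measurable_pi_apply _).inv

/-- The pull-back of holonomies with a diffeomorphism which maps `γ` to `γ'`. -/
def pull {γ γ' : Graph C} {g : C.Diff} (h : g • γ = γ') (A : γ'.Conn) : γ.Conn :=
  ⟨fun e => A.1 ⟨(g : Space ≃ₜ Space) • e.1, smul_mem_of_smul_eq h e.2⟩, fun e => by
    rw [← A.2]
    exact congrArg A.1 (Subtype.ext (OEdge.smul_rev _ _))⟩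

def edgeEquiv {γ γ' : Graph C} {g : C.Diff} (h : g • γ = γ') : γ.edges ≃ γ'.edges :=
  Equiv.ofBijective (fun e => ⟨(g : Space ≃ₜ Space) • e.1, smul_mem_of_smul_eq h e.2⟩) (by
    refine ⟨fun a b hab => Subtype.ext (MulAction.injective (g : Space ≃ₜ Space)
      (congrArg Subtype.val hab)), fun b => ?_⟩
    obtain ⟨a, ha, hab⟩ := mem_smul_edges.1 (show b.1 ∈ (g • γ).edges by rw [h]; exact b.2)
    exact ⟨⟨a, ha⟩, Subtype.ext hab⟩)

theorem measurePreserving_pull {γ γ' : Graph C} {g : C.Diff} (h : g • γ = γ') :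
    MeasurePreserving (pull h) γ'.measure γ.measure := by
  have hm : Measurable (pull h) :=
    Measurable.subtype_mk (measurable_pi_lambda _ fun e =>
      (measurable_pi_apply (⟨(g : Space ≃ₜ Space) • e.1, smul_mem_of_smul_eq h e.2⟩ :
        γ'.edges)).comp measurable_subtype_coe)
  refine ⟨hm, ?_⟩
  have h1 := measurePreserving_piCongrLeft (fun _ : γ'.edges => haarSU2) (edgeEquiv h)
  have h2 : pull h ∘ γ'.toConn ∘ (MeasurableEquiv.piCongrLeft (fun _ : γ'.edges => SU2)
      (edgeEquiv h)) = γ.toConn := by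
    funext a
    have key : ∀ e, (MeasurableEquiv.piCongrLeft (fun _ : γ'.edges => SU2) (edgeEquiv h)) a
        (edgeEquiv h e) = a e := fun e => Equiv.piCongrLeft_apply_apply _ _ _ _
    refine Subtype.ext (funext fun e => ?_)
    have e1 := key e
    have e2 := key ⟨e.1.rev, γ.rev_mem _ e.2⟩
    have e3 : (⟨(edgeEquiv h e).1.rev, γ'.rev_mem _ (edgeEquiv h e).2⟩ : γ'.edges) =
        edgeEquiv h ⟨e.1.rev, γ.rev_mem _ e.2⟩ := Subtype.ext (OEdge.smul_rev _ _).symm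
    change (MeasurableEquiv.piCongrLeft (fun _ : γ'.edges => SU2) (edgeEquiv h)) a
        (edgeEquiv h e) * ((MeasurableEquiv.piCongrLeft (fun _ : γ'.edges => SU2)
          (edgeEquiv h)) a ⟨(edgeEquiv h e).1.rev, _⟩)⁻¹ = _
    rw [e3, e1, e2]
    rfl
  unfold measure
  rw [Measure.map_map hm γ'.measurable_toConn, ← h1.map_eq, Measure.map_map
    (hm.comp γ'.measurable_toConn) h1.measurable, Function.comp_assoc, h2]

/-- The square integrable cylindrical functions over `γ`. -/
abbrev L2 (γ : Graph C) : Type := Lp ℂ 2 γ.measure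

/-- The push-forward of cylindrical functions with a diffeomorphism `g` from `γ` to `γ'`:
`Ψ ↦ (A ↦ Ψ (g^* A))`. -/
def transport {γ γ' : Graph C} {g : C.Diff} (h : g • γ = γ') : γ.L2 →ₗᵢ[ℂ] γ'.L2 :=
  Lp.compMeasurePreservingₗᵢ ℂ (pull h) (measurePreserving_pull h)

/-! ### Spin networks -/

/-- The action of a gauge transformation on holonomies. -/
def gauge (γ : Graph C) (u : Space → SU2) (A : γ.Conn) : γ.Conn :=
  ⟨fun e => u e.1.target * A.1 e * (u e.1.source)⁻¹, fun e => by
    have h1 : e.1.rev.target = e.1.source := by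
      rcases e with ⟨e, he⟩
      induction e using Quotient.inductionOn with
      | h p => simp [OEdge.rev, OEdge.target, OEdge.source, Curve.rev]
    have h2 : e.1.rev.source = e.1.target := by
      rcases e with ⟨e, he⟩
      induction e using Quotient.inductionOn with
      | h p => simp [OEdge.rev, OEdge.target, OEdge.source, Curve.rev]
    simp [h1, h2, A.2, mul_assoc]⟩

/-- The functions `A ↦ ∏_e (x_eᵀ A(e) y_e)^(d_e)` over an orientation `o` of the edges. For fixed `d`
they span the products of matrix coefficients of the irreducible representations of
spin `d_e / 2`, realised on the symmetric tensors `Sym^(d_e) ℂ²`. -/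
def coefficientFunctions (γ : Graph C) (d : γ.edges → ℕ) (o : Finset γ.edges) :
    Set (γ.Conn → ℂ) :=
  {F | ∃ x y : γ.edges → Fin 2 → ℂ,
    F = fun A => ∏ e ∈ o, (x e ⬝ᵥ (A.1 e : Matrix (Fin 2) (Fin 2) ℂ).mulVec (y e)) ^ d e}

/-- `F` is a gauge invariant (generalised) spin network function over `γ`, with the edge `e` coloured
by the spin `d e / 2`: a gauge invariant linear combination of products of matrix coefficients. -/
def IsSpinNetworkFunction (γ : Graph C) (d : γ.edges → ℕ) (F : γ.Conn → ℂ) : Prop :=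
  (∀ u A, F (γ.gauge u A) = F A) ∧
  ∃ o : Finset γ.edges,
    (∀ e : γ.edges, Xor (e ∈ o) ((⟨e.1.rev, γ.rev_mem _ e.2⟩ : γ.edges) ∈ o)) ∧
    F ∈ Submodule.span ℂ (γ.coefficientFunctions d o)

/-- The spin network states over `γ` with the additional conditions that `γ` has no trivial
two-valent vertices and that no edge carries the trivial representation. -/
def spinNetworks (γ : Graph C) : Set γ.L2 :=
  {Ψ | (∀ v, ¬ γ.IsTrivialVertex v) ∧
    ∃ (d : γ.edges → ℕ) (F : γ.Conn → ℂ), (∀ e, d e ≠ 0) ∧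
      (∀ e : γ.edges, d ⟨e.1.rev, γ.rev_mem _ e.2⟩ = d e) ∧
      γ.IsSpinNetworkFunction d F ∧ Ψ =ᵐ[γ.measure] F}

/-- The Hilbert space `ℋ'_γ` spanned by these spin networks. -/
def hilbert (γ : Graph C) : Submodule ℂ γ.L2 := (Submodule.span ℂ γ.spinNetworks).topologicalClosure

/-! ### Group averaging -/

/-- The kinematical inner product of the state `g_* Ψ`, a state over `g • γ`, and the
state `Φ` over `γ'`. States over different graphs are orthogonal. -/
def kinInner {γ γ' : Graph C} (g : C.Diff) (Ψ : γ.L2) (Φ : γ'.L2) : ℂ :=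
  open Classical in if h : g • γ = γ' then inner ℂ (transport h Ψ) Φ else 0

/-- The value `(η(Ψ) | Φ⟩` of the group averaged functional `η(Ψ)` on `Φ`, for states `Ψ` over `γ` and
`Φ` over `γ'`:
`(1 / |GS_γ|) ∑_{ρ ∈ Diff / Diff_γ} ∑_{φ ∈ GS_γ} ⟨ρ_* φ_* Ψ, Φ⟩`. -/
def etaPairing {γ γ' : Graph C} (Ψ : γ.L2) (Φ : γ'.L2) : ℂ :=
  (Nat.card γ.GS : ℂ)⁻¹ * ∑ᶠ ρ : C.Diff ⧸ γ.Diff, ∑ᶠ φ : γ.GS,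
    kinInner (ρ.out * (φ.out : C.Diff)) Ψ Φ

theorem transport_congr {γ γ' : Graph C} {g g' : C.Diff} (h : g • γ = γ') (h' : g' • γ = γ')
    (hg : ∀ e ∈ γ.edges, (g : Space ≃ₜ Space) • e = (g' : Space ≃ₜ Space) • e) :
    transport h = transport h' := by
  have : pull h = pull h' := by
    funext A
    exact Subtype.ext (funext fun e => congrArg A.1 (Subtype.ext (hg e.1 e.2)))
  unfold transport
  congr 1

theorem transport_transport {γ γ' γ'' : Graph C} {g g' : C.Diff} (h : g • γ = γ')
    (h' : g' • γ' = γ'') (x : γ.L2) :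
    transport h' (transport h x) =
      transport (show (g' * g) • γ = γ'' by rw [mul_smul, h, h']) x :=
  (Lp.compMeasurePreserving_comp_apply x (measurePreserving_pull h)
    (measurePreserving_pull h')).symm.trans (by
      have e : pull h ∘ pull h' = pull (show (g' * g) • γ = γ'' by rw [mul_smul, h, h']) := by
        funext A
        exact Subtype.ext (funext fun e => congrArg A.1 (Subtype.ext (mul_smul _ _ _).symm))
      change Lp.compMeasurePreserving (pull h ∘ pull h') _ x = Lp.compMeasurePreserving _ _ x
      congr 2)

instance (γ : Graph C) : Finite γ.GS := by
  let f : γ.GS → (γ.edges → γ.edges) := fun φ e =>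
    ⟨((φ.out : C.Diff) : Space ≃ₜ Space) • e.1, smul_mem_of_smul_eq φ.out.2 e.2⟩
  refine Finite.of_injective f fun φ ψ hfg => ?_
  rw [← φ.out_eq', ← ψ.out_eq']
  refine QuotientGroup.eq.2 fun e he => ?_
  have := congrArg Subtype.val (congrFun hfg ⟨e, he⟩)
  change ((((φ.out : C.Diff) : Space ≃ₜ Space))⁻¹ * ((ψ.out : C.Diff) : Space ≃ₜ Space)) • e = e
  rw [mul_smul, inv_smul_eq_iff]
  exact this.symm

/-- The action of the symmetries of `γ` on the states over `γ`. -/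
def sym (γ : Graph C) (s : γ.Diff) : γ.L2 →ₗᵢ[ℂ] γ.L2 :=
  transport (show (s : C.Diff) • γ = γ from s.2)

theorem sym_def {γ : Graph C} (s : γ.Diff) (h : (s : C.Diff) • γ = γ) : sym γ s = transport h := rfl

theorem sym_eq {γ : Graph C} {s t : γ.Diff} (h : (s : γ.GS) = t) : sym γ s = sym γ t := by
  refine transport_congr _ _ fun e he => ?_
  have := QuotientGroup.eq.1 h e he
  change ((((s : C.Diff) : Space ≃ₜ Space))⁻¹ * ((t : C.Diff) : Space ≃ₜ Space)) • e = e at this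
  rw [mul_smul, inv_smul_eq_iff] at this
  exact this.symm

theorem transport_sym {γ γ' : Graph C} {g k : C.Diff} (h : g • γ = γ') (t : γ.Diff)
    (hk : k • γ = γ') (e : k = g * t) (x : γ.L2) :
    transport h (sym γ t x) = transport hk x := by
  subst e
  exact transport_transport _ _ _

theorem sym_transport {γ γ' : Graph C} {g k : C.Diff} (h : g • γ = γ') (t : γ'.Diff)
    (hk : k • γ = γ') (e : k = t * g) (x : γ.L2) :
    sym γ' t (transport h x) = transport hk x := by
  subst e
  exact transport_transport _ _ _

theorem sym_mul {γ : Graph C} (s t : γ.Diff) (x : γ.L2) :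
    sym γ s (sym γ t x) = sym γ (s * t) x := transport_transport _ _ _

/-- The projection onto the states which are invariant under graph symmetries. -/
def avg (γ : Graph C) : γ.L2 →ₗ[ℂ] γ.L2 :=
  (Nat.card γ.GS : ℂ)⁻¹ • ∑ᶠ φ : γ.GS, (sym γ φ.out).toLinearMap

theorem avg_apply (γ : Graph C) (x : γ.L2) :
    avg γ x = (Nat.card γ.GS : ℂ)⁻¹ • ∑ᶠ φ : γ.GS, sym γ φ.out x := by
  have := Fintype.ofFinite γ.GS
  simp [avg, finsum_eq_sum_of_fintype, LinearMap.sum_apply]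

theorem finsum_sym_mul {γ : Graph C} (s : γ.Diff) (x : γ.L2) :
    ∑ᶠ φ : γ.GS, sym γ (s * φ.out) x = ∑ᶠ φ : γ.GS, sym γ φ.out x := by
  refine finsum_eq_of_bijective (s • ·) (MulAction.bijective s) fun φ => ?_
  refine congrArg (· x) (sym_eq ?_)
  refine Eq.trans ?_ (QuotientGroup.out_eq' (s • φ)).symm
  exact congrArg (s • ·) (QuotientGroup.out_eq' φ)

theorem sym_avg {γ : Graph C} (s : γ.Diff) (x : γ.L2) : sym γ s (avg γ x) = avg γ x := by
  have := Fintype.ofFinite γ.GS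
  rw [avg_apply, map_smul]
  conv_rhs => rw [← finsum_sym_mul s]
  simp only [finsum_eq_sum_of_fintype, map_sum, sym_mul]

theorem inner_avg_right {γ γ' : Graph C} {g : C.Diff} (h : g • γ = γ') (x : γ.L2) (y : γ'.L2) :
    inner ℂ (transport h (avg γ x)) (avg γ' y) = inner ℂ (transport h (avg γ x)) y := by
  have key : ∀ s : γ'.Diff, inner ℂ (transport h (avg γ x)) (sym γ' s y) =
      inner ℂ (transport h (avg γ x)) y := by
    intro s
    have hs : (g⁻¹ * (s : C.Diff) * g) • γ = γ := by
      rw [mul_smul, mul_smul, h, show (s : C.Diff) • γ' = γ' from s.2, ← h, inv_smul_smul]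
    have h1 : sym γ' s (transport h (avg γ x)) = transport h (avg γ x) := by
      conv_rhs => rw [← sym_avg (⟨_, hs⟩ : γ.Diff) x]
      have hk : ((s : C.Diff) * g) • γ = γ' := by
        rw [mul_smul, h]
        exact s.2
      rw [sym_transport h s hk rfl, transport_sym h ⟨_, hs⟩ hk (by simp [mul_assoc])]
    conv_lhs => rw [← h1]
    exact (sym γ' s).inner_map_map _ _
  have := Fintype.ofFinite γ'.GS
  rw [avg_apply γ' y, inner_smul_right, finsum_eq_sum_of_fintype, inner_sum]
  simp only [key, Finset.sum_const, Finset.card_univ, nsmul_eq_mul, Nat.card_eq_fintype_card]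
  have : (Fintype.card γ'.GS : ℂ) ≠ 0 := Nat.cast_ne_zero.2 Fintype.card_ne_zero
  field_simp

theorem etaPairing_of_smul_eq {γ γ' : Graph C} {g : C.Diff} (h : g • γ = γ') (x : γ.L2)
    (y : γ'.L2) : etaPairing x y = inner ℂ (transport h (avg γ x)) y := by
  have := Fintype.ofFinite γ.GS
  have hφ : ∀ φ : γ.GS, (φ.out : C.Diff) • γ = γ := fun φ => φ.out.2
  rw [etaPairing, finsum_eq_single _ (g : C.Diff ⧸ γ.Diff)]
  · set r := ((g : C.Diff ⧸ γ.Diff)).out with hr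
    have hs : g⁻¹ * r ∈ γ.Diff :=
      QuotientGroup.eq.1 ((QuotientGroup.out_eq' (g : C.Diff ⧸ γ.Diff)).symm)
    have h1 : ∀ φ : γ.GS, kinInner (r * (φ.out : C.Diff)) x y =
        inner ℂ (transport h (sym γ (⟨_, hs⟩ * φ.out) x)) y := by
      intro φ
      have hrγ : r • γ = γ' := by
        have : (g⁻¹ * r) • γ = γ := hs
        rw [mul_smul, inv_smul_eq_iff] at this
        rw [this, h]
      have hk : (r * (φ.out : C.Diff)) • γ = γ' := by rw [mul_smul, hφ, hrγ]
      rw [kinInner, dif_pos hk, transport_sym h _ hk (by simp [mul_assoc])]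
    have h2 : avg γ x = (Nat.card γ.GS : ℂ)⁻¹ •
        ∑ᶠ φ : γ.GS, sym γ (⟨_, hs⟩ * φ.out) x := by
      rw [finsum_sym_mul, avg_apply]
    simp only [h1, h2, finsum_eq_sum_of_fintype, map_smul, map_sum, inner_smul_left, sum_inner,
      map_inv₀, Complex.conj_natCast]
  · intro ρ hρ
    refine finsum_eq_zero_of_forall_eq_zero fun φ => dif_neg fun hh => hρ ?_
    rw [mul_smul, hφ, ← h] at hh
    rw [← ρ.out_eq']
    refine QuotientGroup.eq.2 ?_
    change (ρ.out⁻¹ * g) • γ = γ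
    rw [mul_smul, inv_smul_eq_iff, hh]

theorem etaPairing_eq_zero {γ γ' : Graph C} (h : ∀ g : C.Diff, g • γ ≠ γ') (x : γ.L2)
    (y : γ'.L2) : etaPairing x y = 0 := by
  have : ∀ (ρ : C.Diff ⧸ γ.Diff) (φ : γ.GS), kinInner (ρ.out * (φ.out : C.Diff)) x y = 0 :=
    fun ρ φ => dif_neg (h _)
  simp [etaPairing, this]

/-- The set of diffeomorphism equivalence classes of graphs. -/
abbrev Class (C : SmoothCategory) : Type := MulAction.orbitRel.Quotient C.Diff (Graph C)

/-- The diffeomorphism equivalence class `[γ]`. -/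
def cls (γ : Graph C) : Class C := Quotient.mk _ γ

theorem cls_eq_iff {γ γ' : Graph C} : γ.cls = γ'.cls ↔ ∃ g : C.Diff, g • γ = γ' := by
  refine ⟨fun h => ?_, fun ⟨g, h⟩ => ?_⟩
  · exact (Quotient.exact h.symm : MulAction.orbitRel C.Diff (Graph C) γ' γ)
  · exact Quotient.sound ((MulAction.orbitRel C.Diff (Graph C)).symm ⟨g, h⟩)

theorem exists_smul_eq_out (γ : Graph C) : ∃ g : C.Diff, g • γ = γ.cls.out :=
  cls_eq_iff.1 (Quotient.out_eq γ.cls).symm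

/-- An auxiliary realisation of averaged states in a sum of Hilbert spaces over representatives of
the diffeomorphism classes; it is only used to see that the inner product is positive. -/
def realise (γ : Graph C) : γ.L2 →ₗ[ℂ] lp (fun q : Class C => (Quotient.out q : Graph C).L2) 2 :=
  open Classical in
  (lp.lsingle 2 γ.cls).comp ((transport γ.exists_smul_eq_out.choose_spec).toLinearMap.comp γ.avg)

theorem etaPairing_eq_inner {γ γ' : Graph C} (x : γ.L2) (y : γ'.L2) :
    etaPairing x y = inner ℂ (realise γ x) (realise γ' y) := by
  classical
  have key : ∀ (q q' : Class C) (g g' : C.Diff) (h : g • γ = q.out) (h' : g' • γ' = q'.out),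
      q = γ.cls → q' = γ'.cls →
      etaPairing x y = inner ℂ
        (lp.single (E := fun q : Class C => (Quotient.out q : Graph C).L2) 2 q
          (transport h (avg γ x)))
        (lp.single (E := fun q : Class C => (Quotient.out q : Graph C).L2) 2 q'
          (transport h' (avg γ' y))) := by
    intro q q' g g' h h' hq hq'
    rw [lp.inner_single_left]
    by_cases hqq : q = q'
    · subst hqq
      rw [lp.single_apply_self]
      have h3 : (g'⁻¹ * g) • γ = γ' := by rw [mul_smul, h, ← h', inv_smul_smul]
      rw [etaPairing_of_smul_eq h3, ← inner_avg_right,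
        ← (transport h').inner_map_map, transport_transport]
      congr 2
      refine transport_congr _ _ fun e _ => ?_
      congr 2
      simp
    · rw [lp.single_apply_ne _ _ _ hqq, inner_zero_right]
      refine etaPairing_eq_zero (fun g hg => hqq ?_) _ _
      rw [hq, hq', cls_eq_iff]
      exact ⟨g, hg⟩
  exact key _ _ _ _ _ _ rfl rfl

end Graph

/-! ### The diffeomorphism invariant Hilbert space -/

/-- The finite linear combinations of states in the Hilbert spaces `ℋ'_γ`. -/
abbrev AlgState (C : SmoothCategory) : Type := Π₀ γ : Graph C, γ.hilbert

/-- A state over `γ`, as an element of the direct sum. -/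
def AlgState.of (γ : Graph C) : γ.hilbert →ₗ[ℂ] AlgState C :=
  open Classical in DFinsupp.lsingle (R := ℂ) (M := fun γ : Graph C => γ.hilbert) γ

/-- The inner product `(η(Ψ) | η(Φ)) = (η(Ψ) | Φ⟩`. -/
def AlgState.form (Ψ Φ : AlgState C) : ℂ :=
  open Classical in
  DFinsupp.sum Ψ fun _ x => DFinsupp.sum Φ fun _ y => Graph.etaPairing x.1 y.1

def AlgState.realise :
    AlgState C →ₗ[ℂ] lp (fun q : Graph.Class C => (Quotient.out q : Graph C).L2) 2 :=
  open Classical in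
  DFinsupp.lsum ℂ fun γ => (Graph.realise γ).comp γ.hilbert.subtype

theorem AlgState.form_eq (Ψ Φ : AlgState C) :
    AlgState.form Ψ Φ = inner ℂ (realise Ψ) (realise Φ) := by
  classical
  have h : ∀ Ψ : AlgState C, realise Ψ = DFinsupp.sum Ψ fun γ x => Graph.realise γ x.1 := by
    intro Ψ
    rw [realise, DFinsupp.lsum_apply_apply, DFinsupp.sumAddHom_apply]
    rfl
  rw [h, h]
  simp only [AlgState.form, DFinsupp.sum, sum_inner, inner_sum, Graph.etaPairing_eq_inner]
  exact Finset.sum_comm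

instance : PreInnerProductSpace.Core ℂ (AlgState C) where
  inner := AlgState.form
  conj_inner_symm x y := by
    change conj (AlgState.form y x) = AlgState.form x y
    rw [AlgState.form_eq, AlgState.form_eq, inner_conj_symm]
  re_inner_nonneg x := by
    rw [AlgState.form_eq]
    exact inner_self_nonneg
  add_left x y z := by
    change AlgState.form (x + y) z = AlgState.form x z + AlgState.form y z
    rw [AlgState.form_eq, AlgState.form_eq, AlgState.form_eq, map_add, inner_add_left]
  smul_left x y r := by
    change AlgState.form (r • x) y = conj r * AlgState.form x y
    rw [AlgState.form_eq, AlgState.form_eq, map_smul, inner_smul_left]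

instance : SeminormedAddCommGroup (AlgState C) :=
  InnerProductSpace.Core.toSeminormedAddCommGroup (𝕜 := ℂ)

instance : InnerProductSpace ℂ (AlgState C) := InnerProductSpace.ofCore _

/-- The Hilbert space `ℋ_diff = η(ℋ)`: the completion of the space of averaged states with respect to
the inner product `(η(Ψ) | η(Φ)) = (η(Ψ) | Φ⟩`. Passing to the completion also identifies `Ψ` and `Φ`
if the functionals `η(Ψ)` and `η(Φ)` agree. -/
abbrev HDiff (C : SmoothCategory) : Type := UniformSpace.Completion (AlgState C)

/-- The averaged state `|η(Ψ))` in `ℋ_diff` of a state `Ψ` over `γ`. -/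
def eta (γ : Graph C) (Ψ : γ.hilbert) : HDiff C := (AlgState.of γ Ψ : AlgState C)

theorem inner_eta {γ γ' : Graph C} (Ψ : γ.hilbert) (Φ : γ'.hilbert) :
    inner ℂ (eta γ Ψ) (eta γ' Φ) = Graph.etaPairing Ψ.1 Φ.1 := by
  classical
  rw [eta, eta, UniformSpace.Completion.inner_coe]
  change AlgState.form _ _ = _
  rw [AlgState.form_eq, Graph.etaPairing_eq_inner]
  have h : ∀ (γ : Graph C) (Ψ : γ.hilbert), AlgState.realise (AlgState.of γ Ψ) =
      Graph.realise γ Ψ.1 := fun γ Ψ => by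
    simp [AlgState.realise, AlgState.of]
  rw [h, h]

/-- The space `η(ℋ'_n)` of averaged states over graphs with `n` unlinked components. -/
def etaSpace (C : SmoothCategory) (n : ℕ) : Submodule ℂ (HDiff C) :=
  (Submodule.span ℂ {ψ | ∃ γ ∈ Graph.withComponents C n, ∃ Ψ, ψ = eta γ Ψ}).topologicalClosure

/-- The type `Γ_n` of graphs with `n` unlinked components. -/
abbrev GraphN (C : SmoothCategory) (n : ℕ) : Type := Graph.withComponents C n

/-- The averaged state `|η(Ψ))` as an element of `η(ℋ'_n)`. -/
def etaN {n : ℕ} (γ : GraphN C n) (Ψ : γ.1.hilbert) : etaSpace C n :=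
  ⟨eta γ.1 Ψ, Submodule.le_topologicalClosure _ (Submodule.subset_span ⟨γ.1, γ.2, Ψ, rfl⟩)⟩

/-! ### The symmetric Fock space -/

section Fock

open scoped TensorProduct

variable (V : Type) [NormedAddCommGroup V] [InnerProductSpace ℂ V]

/-- The algebraic tensor power `V ⊗ ⋯ ⊗ V`. -/
def AlgTensor (n : ℕ) : Type := ⨂[ℂ] _ : Fin n, V

variable {V} {n : ℕ}

instance : AddCommGroup (AlgTensor V n) := inferInstanceAs (AddCommGroup (⨂[ℂ] _ : Fin n, V))

instance : Module ℂ (AlgTensor V n) := inferInstanceAs (Module ℂ (⨂[ℂ] _ : Fin n, V))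

/-- The pure tensor `v₁ ⊗ ⋯ ⊗ vₙ`. -/
def AlgTensor.pure : MultilinearMap ℂ (fun _ : Fin n => V) (AlgTensor V n) :=
  PiTensorProduct.tprod ℂ

theorem AlgTensor.induction {P : AlgTensor V n → Prop}
    (pure : ∀ (a : ℂ) v, P (a • AlgTensor.pure v)) (add : ∀ x y, P x → P y → P (x + y))
    (x : AlgTensor V n) : P x :=
  PiTensorProduct.induction_on x pure add

/-- The linear functional `⊗ v ↦ ∏ ⟪w_l, v_l⟫`. -/
def AlgTensor.functional (w : Fin n → V) : AlgTensor V n →ₗ[ℂ] ℂ :=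
  PiTensorProduct.lift (MultilinearMap.mkPiAlgebra ℂ (Fin n) ℂ |>.compLinearMap
    fun l => (innerSL ℂ (w l)).toLinearMap)

theorem AlgTensor.functional_pure (w v : Fin n → V) :
    AlgTensor.functional w (AlgTensor.pure v) = ∏ l, inner ℂ (w l) (v l) := by
  refine (PiTensorProduct.lift.tprod _).trans ?_
  simp

theorem AlgTensor.prod_update [DecidableEq (Fin n)] (w v : Fin n → V) (l : Fin n) (a : V) :
    ∏ k, inner ℂ (Function.update w l a k) (v k) =
      inner ℂ a (v l) * ∏ k ∈ Finset.univ.erase l, inner ℂ (w k) (v k) := by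
  rw [← Finset.mul_prod_erase _ _ (Finset.mem_univ l), Function.update_self]
  congr 1
  refine Finset.prod_congr rfl fun k hk => ?_
  rw [Function.update_of_ne (Finset.ne_of_mem_erase hk)]

/-- The sesquilinear form on the tensor power with
`(⊗ v, ⊗ w) ↦ ∏ ⟪v_l, w_l⟫`, as a linear function of its second argument. -/
def AlgTensor.formAux : AlgTensor V n →ₗ[ℂ] AlgTensor V n →ₗ⋆[ℂ] ℂ :=
  PiTensorProduct.lift
    { toFun := fun w => (starLinearEquiv ℂ (A := ℂ)).toLinearMap.comp (AlgTensor.functional w)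
      map_update_add' := by
        intro _ w l a b
        ext x
        induction x using AlgTensor.induction with
        | pure c v =>
          simp [AlgTensor.functional_pure, AlgTensor.prod_update, add_mul, mul_add]
        | add x y hx hy => simp only [map_add, hx, hy]
      map_update_smul' := by
        intro _ w l a b
        ext x
        induction x using AlgTensor.induction with
        | pure c v =>
          simp only [LinearMap.comp_apply, LinearEquiv.coe_coe, map_smul,
            AlgTensor.functional_pure, AlgTensor.prod_update, inner_smul_left,
            LinearMap.smul_apply, starLinearEquiv_apply, smul_eq_mul, star_mul', RCLike.star_def,
            Complex.conj_conj]
          ring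
        | add x y hx hy => simp only [map_add, hx, hy] }

def AlgTensor.form (x y : AlgTensor V n) : ℂ := AlgTensor.formAux y x

theorem AlgTensor.form_pure (v w : Fin n → V) :
    AlgTensor.form (AlgTensor.pure v) (AlgTensor.pure w) = ∏ l, inner ℂ (v l) (w l) := by
  have : AlgTensor.formAux (AlgTensor.pure w) =
      (starLinearEquiv ℂ (A := ℂ)).toLinearMap.comp (AlgTensor.functional w) :=
    PiTensorProduct.lift.tprod _
  rw [AlgTensor.form, this]
  simp [AlgTensor.functional_pure]

theorem AlgTensor.exists_sum (x : AlgTensor V n) :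
    ∃ (ι : Type) (_ : Fintype ι) (a : ι → ℂ) (v : ι → Fin n → V),
      x = ∑ i, a i • AlgTensor.pure (v i) := by
  induction x using AlgTensor.induction with
  | pure a v => exact ⟨Unit, inferInstance, fun _ => a, fun _ => v, by simp⟩
  | add x y hx hy =>
    obtain ⟨ι, _, a, v, rfl⟩ := hx
    obtain ⟨κ, _, b, w, rfl⟩ := hy
    exact ⟨ι ⊕ κ, inferInstance, Sum.elim a b, Sum.elim v w, by simp⟩

theorem AlgTensor.form_sum {ι κ : Type} [Fintype ι] [Fintype κ] (a : ι → ℂ) (v : ι → Fin n → V)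
    (b : κ → ℂ) (w : κ → Fin n → V) :
    AlgTensor.form (∑ i, a i • AlgTensor.pure (v i)) (∑ j, b j • AlgTensor.pure (w j)) =
      ∑ i, ∑ j, conj (a i) * b j * ∏ l, inner ℂ (v i l) (w j l) := by
  have h : ∀ (x y : Fin n → V), AlgTensor.formAux (AlgTensor.pure y) (AlgTensor.pure x) =
      ∏ l, inner ℂ (x l) (y l) := AlgTensor.form_pure
  simp only [AlgTensor.form, map_sum, map_smul, map_smulₛₗ, LinearMap.sum_apply,
    LinearMap.smul_apply, h, smul_eq_mul, mul_assoc, Finset.mul_sum]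

open scoped ComplexOrder in
/-- Positivity is a consequence of the Schur product theorem for Gram matrices. -/
theorem AlgTensor.re_form_nonneg (x : AlgTensor V n) : 0 ≤ RCLike.re (AlgTensor.form x x) := by
  classical
  obtain ⟨ι, _, a, v, rfl⟩ := x.exists_sum
  have key : ∀ s : Finset (Fin n),
      (Matrix.of fun i j : ι => ∏ l ∈ s, inner ℂ (v i l) (v j l)).PosSemidef := by
    intro s
    induction s using Finset.induction_on with
    | empty =>
      have : (Matrix.of fun i j : ι => ∏ l ∈ (∅ : Finset (Fin n)), inner ℂ (v i l) (v j l)) =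
          Matrix.gram ℂ (fun _ : ι => (1 : ℂ)) := by
        ext i j
        simp [Matrix.gram]
      rw [this]
      exact Matrix.posSemidef_gram _ _
    | insert l s hl ih =>
      have : (Matrix.of fun i j : ι => ∏ l ∈ insert l s, inner ℂ (v i l) (v j l)) =
          Matrix.hadamard (Matrix.gram ℂ (fun i : ι => v i l))
            (Matrix.of fun i j : ι => ∏ l ∈ s, inner ℂ (v i l) (v j l)) := by
        ext i j
        simp [Matrix.gram, Matrix.hadamard, Finset.prod_insert hl]
      rw [this]
      exact (Matrix.posSemidef_gram _ _).hadamard ih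
  have h := (key Finset.univ).dotProduct_mulVec_nonneg a
  rw [AlgTensor.form_sum]
  have e : star a ⬝ᵥ (Matrix.of fun i j : ι => ∏ l, inner ℂ (v i l) (v j l)).mulVec a =
      ∑ i, ∑ j, conj (a i) * a j * ∏ l, inner ℂ (v i l) (v j l) := by
    simp only [dotProduct, Matrix.mulVec, Matrix.of_apply, Pi.star_apply, RCLike.star_def,
      Finset.mul_sum]
    refine Finset.sum_congr rfl fun i _ => Finset.sum_congr rfl fun j _ => ?_
    ring
  rw [← e]
  exact (Complex.le_def.1 h).1

theorem AlgTensor.conj_form (x y : AlgTensor V n) :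
    conj (AlgTensor.form y x) = AlgTensor.form x y := by
  obtain ⟨ι, _, a, v, rfl⟩ := x.exists_sum
  obtain ⟨κ, _, b, w, rfl⟩ := y.exists_sum
  rw [AlgTensor.form_sum, AlgTensor.form_sum]
  simp only [map_sum, map_mul, map_prod, Complex.conj_conj, inner_conj_symm]
  rw [Finset.sum_comm]
  refine Finset.sum_congr rfl fun i _ => Finset.sum_congr rfl fun j _ => ?_
  ring

instance : PreInnerProductSpace.Core ℂ (AlgTensor V n) where
  inner := AlgTensor.form
  conj_inner_symm := AlgTensor.conj_form
  re_inner_nonneg := AlgTensor.re_form_nonneg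
  add_left x y z := map_add (AlgTensor.formAux z) x y
  smul_left x y r := map_smulₛₗ (AlgTensor.formAux y) r x

instance : SeminormedAddCommGroup (AlgTensor V n) :=
  InnerProductSpace.Core.toSeminormedAddCommGroup (𝕜 := ℂ)

instance : InnerProductSpace ℂ (AlgTensor V n) := InnerProductSpace.ofCore _

variable (V) in
/-- The Hilbert space tensor power `V^{⊗ n}`: the completion of the algebraic tensor power with
respect to the inner product with `⟪⊗ v, ⊗ w⟫ = ∏ ⟪v_l, w_l⟫`. -/
abbrev Tensor (n : ℕ) : Type := UniformSpace.Completion (AlgTensor V n)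

/-- The pure tensor `v₁ ⊗ ⋯ ⊗ vₙ` in the Hilbert space tensor power. -/
def pureTensor (v : Fin n → V) : Tensor V n := (AlgTensor.pure v : AlgTensor V n)

theorem inner_pureTensor (v w : Fin n → V) :
    inner ℂ (pureTensor v) (pureTensor w) = ∏ l, inner ℂ (v l) (w l) :=
  (UniformSpace.Completion.inner_coe _ _).trans (AlgTensor.form_pure v w)

variable (V) in
/-- The symmetric part of `V^{⊗ n}`, generated by the symmetrised pure tensors. -/
def symTensor (n : ℕ) : Submodule ℂ (Tensor V n) :=
  (Submodule.span ℂ {x | ∃ v : Fin n → V,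
    x = ∑ σ : Equiv.Perm (Fin n), pureTensor (fun l => v (σ l))}).topologicalClosure

/-- A symmetrised convergent series of pure tensors is a symmetric tensor. -/
theorem sum_pureTensor_mem {ι : Type} (f : ι → ℂ) (v : ι → Fin n → V)
    (hf : ∀ σ : Equiv.Perm (Fin n), Summable fun I => f I • pureTensor fun l => v I (σ l)) (a : ℂ) :
    a • ∑ σ : Equiv.Perm (Fin n), ∑' I, f I • (pureTensor fun l => v I (σ l)) ∈ symTensor V n := by
  refine Submodule.smul_mem _ _ ?_
  rw [← Summable.tsum_finsetSum fun σ _ => hf σ]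
  have hs : Summable fun I => ∑ σ : Equiv.Perm (Fin n), f I • pureTensor fun l => v I (σ l) :=
    summable_sum fun σ _ => hf σ
  refine IsClosed.mem_of_tendsto (Submodule.isClosed_topologicalClosure _) hs.hasSum
    (Filter.Eventually.of_forall fun s => Submodule.sum_mem _ fun I _ => ?_)
  rw [← Finset.smul_sum]
  exact Submodule.smul_mem _ _ (Submodule.le_topologicalClosure _ (Submodule.subset_span ⟨_, rfl⟩))

variable (V) in
/-- The full Fock space, the Hilbert sum of all tensor powers. -/
abbrev FullFock : Type := lp (fun n : ℕ => Tensor V n) 2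

variable (V) in
/-- The symmetric Fock space over `V`, as a subspace of the full Fock space. -/
def SymFock : Submodule ℂ (FullFock V) where
  carrier := {x | ∀ n, x n ∈ symTensor V n}
  add_mem' hx hy n := (symTensor V n).add_mem (hx n) (hy n)
  zero_mem' n := (symTensor V n).zero_mem
  smul_mem' c _ hx n := (symTensor V n).smul_mem c (hx n)

end Fock

/-! ### Component Fock space -/

/-- The component Fock space `𝔉`, i.e. the symmetric Fock space over `η(ℋ'₁)`. -/
abbrev ComponentFock (C : SmoothCategory) : Type := SymFock (etaSpace C 1)

/-- A choice of spin network bases for the one-component graphs: for each graph `c`, an orthonormal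
basis `S c` of `ℋ'_c` which consists of spin network states. Graphs in the same diffeomorphism class
share a set of labels, and states with the same label are related by a diffeomorphism. -/
structure SpinNetworkBases (C : SmoothCategory) where
  Label : Graph.Class C → Type
  S : ∀ c : GraphN C 1, HilbertBasis (Label c.1.cls) ℂ c.1.hilbert
  mem_spinNetworks : ∀ c I, (S c I : c.1.L2) ∈ c.1.spinNetworks
  covariant : ∀ (c c' : GraphN C 1) (h : c.1.cls = c'.1.cls),
    ∃ (g : C.Diff) (hg : g • c.1 = c'.1), ∀ I : Label c.1.cls,
      Graph.transport hg (S c I : c.1.L2) = (S c' (cast (congrArg Label h) I) : c'.1.L2)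

namespace SpinNetworkBases

variable (B : SpinNetworkBases C) {n n' : ℕ}

/-- The multi-indices `I = (I₁, …, Iₙ)` for the graphs `c₁, …, cₙ`. -/
abbrev Labels (c : Fin n → GraphN C 1) : Type := ∀ k, B.Label (c k).1.cls

variable {B} in
/-- The multi-index `τ I = (I_{τ 1}, …, I_{τ n})`, if the graph `c' (τ l)` is diffeomorphic
to `c l` for every `l`. -/
def Labels.permute {c : Fin n → GraphN C 1} {c' : Fin n' → GraphN C 1} {τ : Fin n ≃ Fin n'}
    (hτ : ∀ l, (c' (τ l)).1.cls = (c l).1.cls) (I : B.Labels c') : B.Labels c :=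
  fun l => cast (congrArg B.Label (hτ l)) (I (τ l))

/-- The tensor `|η(S_{c_{σ 1}}^{I_{σ 1}})) ⊗ ⋯ ⊗ |η(S_{c_{σ n}}^{I_{σ n}}))`. -/
def tensor (c : Fin n → GraphN C 1) (I : B.Labels c) (σ : Equiv.Perm (Fin n)) :
    Tensor (etaSpace C 1) n :=
  pureTensor fun l => etaN (c (σ l)) (B.S (c (σ l)) (I (σ l)))

/-- The coefficients `f_I` define a state: the sums over `I` converge. (It suffices that they are
square summable; in particular this includes all `f` with finite support.) -/
def IsCoefficients (c : Fin n → GraphN C 1) (f : B.Labels c → ℂ) : Prop :=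
  ∀ σ : Equiv.Perm (Fin n), Summable fun I => f I • B.tensor c I σ

theorem sum_tensor_mem (c : Fin n → GraphN C 1) (f : B.Labels c → ℂ) (hf : B.IsCoefficients c f) :
    (n.factorial : ℂ)⁻¹ • ∑ σ : Equiv.Perm (Fin n), ∑' I, f I • B.tensor c I σ ∈
      symTensor (etaSpace C 1) n := by
  exact sum_pureTensor_mem f (fun I l => etaN (c l) (B.S (c l) (I l))) hf _

/-- The `n`-particle state
`|f) = (1 / n!) ∑_σ ∑_I f_I |η(S_{c_{σ 1}}^{I_{σ 1}})) ⊗ ⋯ ⊗ |η(S_{c_{σ n}}^{I_{σ n}}))`. -/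
def state (c : Fin n → GraphN C 1) (f : B.Labels c → ℂ) (hf : B.IsCoefficients c f) :
    ComponentFock C :=
  ⟨lp.single 2 n ((n.factorial : ℂ)⁻¹ •
      ∑ σ : Equiv.Perm (Fin n), ∑' I, f I • B.tensor c I σ), fun m => by
    by_cases h : m = n
    · subst h
      rw [lp.single_apply_self]
      exact B.sum_tensor_mem c f hf
    · rw [lp.single_apply_ne _ _ _ h]
      exact Submodule.zero_mem _⟩

end SpinNetworkBases

/-- The multiset `{[c₁], …, [cₙ]}` of diffeomorphism equivalence classes. -/
def classes {n : ℕ} (c : Fin n → GraphN C 1) : Multiset (Graph.Class C) :=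
  Finset.univ.val.map fun k => (c k).1.cls

/-- The group `S_n^p` of permutations which preserve the partition of `{1, …, n}` into the sets of
indices with diffeomorphic graphs. -/
def partitionPerms {n : ℕ} (c : Fin n → GraphN C 1) : Subgroup (Equiv.Perm (Fin n)) where
  carrier := {π | ∀ l, (c (π l)).1.cls = (c l).1.cls}
  one_mem' _ := rfl
  mul_mem' hσ hπ l := (hσ _).trans (hπ l)
  inv_mem' {π} hπ l := by
    have h := hπ (π.symm l)
    rw [Equiv.apply_symm_apply] at h
    exact h.symm

/-- The summand `conj (f_{π I}) f'_{I'} ∏_l (η(S_{c_l}^{I_l}), η(S_{c_l}^{I'_{τ l}}))`. -/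
def SpinNetworkBases.summand (B : SpinNetworkBases C) {n n' : ℕ} {c : Fin n → GraphN C 1}
    {c' : Fin n' → GraphN C 1} (f : B.Labels c → ℂ) (f' : B.Labels c' → ℂ) {τ : Fin n ≃ Fin n'}
    (hτ : ∀ l, (c' (τ l)).1.cls = (c l).1.cls) (π : partitionPerms c)
    (I : B.Labels c) (I' : B.Labels c') : ℂ :=
  conj (f (I.permute π.2)) * f' I' *
    ∏ l, inner ℂ (eta (c l).1 (B.S (c l) (I l))) (eta (c l).1 (B.S (c l) (I'.permute hτ l)))

end LQG

end

/-!
The inner product of two symmetrised `n`-particle states is a double sum over permutations `σ`, `σ'`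
of pairings of series of pure tensors. Continuity of the inner product allows these pairings to be
expanded term by term, first in the labels `I'` and then in the labels `I`. A simultaneous
permutation of the factors of two pure tensors does not change their inner product
(`inner_tensor_mul`), so only the relative permutation `ρ = σ' * σ⁻¹` matters and the double sum
collapses to `(1 / n!) ∑_ρ` (`inner_state`).

Averaged states over graphs in different diffeomorphism classes are orthogonal
(`inner_eta_eq_zero`). Hence `ρ` contributes only if `[c' (ρ l)] = [c l]` for all `l`. If the
multisets of classes differ there is no such `ρ`; otherwise there is one, `τ` say, and all of them
are the products `τ * π` with `π` in `partitionPerms c` (`inner_state_eq_sum`).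

Finally, `η` does not distinguish a state from its image under a diffeomorphism (`eta_transport`), so
covariance of the spin network bases gives equal averaged states for diffeomorphic graphs and equal
labels (`eta_cast`). After substituting `π I` for `I`, all the states in the contribution of `τ * π`
can therefore be moved to the graphs `c l`, which gives the stated summands (`summand_eq`).
-/

namespace LQG

section General

/-! ### Matching of families and inner products of series -/

/-- Two maps from finite types with the same multiset of values differ by a bijection of their
domains: choose a bijection between the fibres over each value. -/
theorem exists_equiv_of_map_univ_eq {α β γ : Type*} [Fintype α] [Fintype β] {f : α → γ} {g : β → γ}
    (h : Finset.univ.val.map f = Finset.univ.val.map g) : ∃ τ : α ≃ β, ∀ a, g (τ a) = f a := by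
  classical
  have key : ∀ q, Nonempty ({a // f a = q} ≃ {b // g b = q}) := by
    intro q
    have hq := congrArg (Multiset.count q) h
    rw [Multiset.count_map, Multiset.count_map] at hq
    refine ⟨Fintype.equivOfCardEq ?_⟩
    rw [Fintype.card_subtype, Fintype.card_subtype]
    simpa only [Finset.card_def, Finset.filter_val, eq_comm] using hq
  exact ⟨Equiv.ofFiberEquiv fun q => (key q).some, Equiv.ofFiberEquiv_map _⟩

variable {E ι κ : Type*} [NormedAddCommGroup E] [InnerProductSpace ℂ E]

theorem summable_conj_mul_inner_left {a : ι → ℂ} {u : ι → E} (hu : Summable fun i => a i • u i)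
    (y : E) : Summable fun i => conj (a i) * inner ℂ (u i) y := by
  have := ((innerSL ℂ).flip y).summable hu
  simpa [inner_smul_left] using this

theorem inner_tsum_left {a : ι → ℂ} {u : ι → E} (hu : Summable fun i => a i • u i) (y : E) :
    inner ℂ (∑' i, a i • u i) y = ∑' i, conj (a i) * inner ℂ (u i) y := by
  have := ((innerSL ℂ).flip y).map_tsum hu
  simpa [inner_smul_left] using this

theorem summable_mul_inner_right {b : κ → ℂ} {v : κ → E} (hv : Summable fun j => b j • v j)
    (x : E) : Summable fun j => b j * inner ℂ x (v j) := by
  have := (innerSL ℂ x).summable hv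
  simpa [inner_smul_right] using this

theorem inner_tsum_right {b : κ → ℂ} {v : κ → E} (hv : Summable fun j => b j • v j) (x : E) :
    inner ℂ x (∑' j, b j • v j) = ∑' j, b j * inner ℂ x (v j) := by
  have := (innerSL ℂ x).map_tsum hv
  simpa [inner_smul_right] using this

theorem tsum_tsum_conj_mul_mul_inner {a : ι → ℂ} {u : ι → E} {b : κ → ℂ} {v : κ → E}
    (hv : Summable fun j => b j • v j) (i : ι) :
    ∑' j, conj (a i) * b j * inner ℂ (u i) (v j) =
      conj (a i) * inner ℂ (u i) (∑' j, b j • v j) := by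
  rw [inner_tsum_right hv, ← tsum_mul_left]
  simp only [mul_assoc]

theorem inner_tsum_tsum {a : ι → ℂ} {u : ι → E} {b : κ → ℂ} {v : κ → E}
    (hu : Summable fun i => a i • u i) (hv : Summable fun j => b j • v j) :
    inner ℂ (∑' i, a i • u i) (∑' j, b j • v j) =
      ∑' i, ∑' j, conj (a i) * b j * inner ℂ (u i) (v j) := by
  simp only [tsum_tsum_conj_mul_mul_inner hv, inner_tsum_left hu]

end General

/-! ### Averaged states and diffeomorphisms -/

variable {C : SmoothCategory}

theorem inner_eta_eq_zero {γ γ' : Graph C} (h : γ.cls ≠ γ'.cls) (Ψ : γ.hilbert)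
    (Φ : γ'.hilbert) : inner ℂ (eta γ Ψ) (eta γ' Φ) = 0 := by
  rw [inner_eta]
  exact Graph.etaPairing_eq_zero (fun g hg => h (Graph.cls_eq_iff.2 ⟨g, hg⟩)) _ _

/-- Averaging is invariant under moving the second argument by a diffeomorphism, since a
diffeomorphism `k` from `γ` to `γ'` yields `g * k` from `γ` to `γ''`, and transport by `g` is
isometric. -/
theorem etaPairing_transport_right {γ γ' γ'' : Graph C} {g : C.Diff} (hg : g • γ' = γ'')
    (x : γ.L2) (y : γ'.L2) :
    Graph.etaPairing x (Graph.transport hg y) = Graph.etaPairing x y := by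
  by_cases h : ∃ k : C.Diff, k • γ = γ'
  · obtain ⟨k, hk⟩ := h
    have hgk : (g * k) • γ = γ'' := by rw [mul_smul, hk, hg]
    rw [Graph.etaPairing_of_smul_eq hgk, Graph.etaPairing_of_smul_eq hk,
      ← Graph.transport_transport hk hg, LinearIsometry.inner_map_map]
  · rw [Graph.etaPairing_eq_zero (fun k hk => h ⟨k, hk⟩), Graph.etaPairing_eq_zero]
    intro k hk
    exact h ⟨g⁻¹ * k, by rw [mul_smul, hk, ← hg, inv_smul_smul]⟩

/-- `η` does not distinguish a state from its image under a diffeomorphism: their difference is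
orthogonal to both of them, hence of norm zero. -/
theorem eta_transport {γ γ' : Graph C} {g : C.Diff} (hg : g • γ = γ') (Ψ : γ.hilbert)
    (Φ : γ'.hilbert) (h : Graph.transport hg Ψ.1 = Φ.1) : eta γ' Φ = eta γ Ψ := by
  have key : ∀ (δ : Graph C) (Θ : δ.hilbert),
      inner ℂ (eta δ Θ) (eta γ' Φ) = inner ℂ (eta δ Θ) (eta γ Ψ) := fun δ Θ => by
    rw [inner_eta, inner_eta, ← h, etaPairing_transport_right]
  rw [← sub_eq_zero, ← inner_self_eq_zero (𝕜 := ℂ), inner_sub_left, inner_sub_right,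
    inner_sub_right, key, key, sub_self, sub_self, sub_self]

namespace SpinNetworkBases

variable (B : SpinNetworkBases C) {n n' : ℕ}

theorem eta_cast {c c' : GraphN C 1} (h : c'.1.cls = c.1.cls) (I : B.Label c'.1.cls) :
    eta c.1 (B.S c (cast (congrArg B.Label h) I)) = eta c'.1 (B.S c' I) := by
  obtain ⟨g, hg, hS⟩ := B.covariant c' c h
  exact eta_transport hg _ _ (hS I)

/-! ### Pairings of tensors of averaged spin networks -/

theorem inner_tensor (c c' : Fin n → GraphN C 1) (I : B.Labels c) (I' : B.Labels c')
    (σ σ' : Equiv.Perm (Fin n)) :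
    inner ℂ (B.tensor c I σ) (B.tensor c' I' σ') =
      ∏ l, inner ℂ (eta (c (σ l)).1 (B.S (c (σ l)) (I (σ l))))
        (eta (c' (σ' l)).1 (B.S (c' (σ' l)) (I' (σ' l)))) :=
  inner_pureTensor _ _

/-- Permuting the factors of both tensors simultaneously does not change the pairing. -/
theorem inner_tensor_mul (c c' : Fin n → GraphN C 1) (I : B.Labels c) (I' : B.Labels c')
    (σ σ' ρ : Equiv.Perm (Fin n)) :
    inner ℂ (B.tensor c I (σ * ρ)) (B.tensor c' I' (σ' * ρ)) =
      inner ℂ (B.tensor c I σ) (B.tensor c' I' σ') := by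
  rw [inner_tensor, inner_tensor]
  exact Equiv.prod_comp ρ fun l => inner ℂ (eta (c (σ l)).1 (B.S (c (σ l)) (I (σ l))))
        (eta (c' (σ' l)).1 (B.S (c' (σ' l)) (I' (σ' l))))

theorem inner_tensor_eq_zero (c c' : Fin n → GraphN C 1) (I : B.Labels c) (I' : B.Labels c')
    {ρ : Equiv.Perm (Fin n)} (hρ : ¬ ∀ l, (c' (ρ l)).1.cls = (c l).1.cls) :
    inner ℂ (B.tensor c I 1) (B.tensor c' I' ρ) = 0 := by
  obtain ⟨l, hl⟩ := not_forall.1 hρ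
  rw [inner_tensor]
  exact Finset.prod_eq_zero (Finset.mem_univ l) (inner_eta_eq_zero (Ne.symm hl) _ _)

variable {B}

theorem Labels.permute_bijective {c : Fin n → GraphN C 1} (π : partitionPerms c) :
    Function.Bijective fun I : B.Labels c => I.permute π.2 := by
  constructor
  · intro I J h
    funext k
    obtain ⟨l, rfl⟩ := π.1.surjective k
    exact (cast_bijective _).injective (congrFun h l)
  · intro J
    have hπ : ∀ k, (c (π.1.symm k)).1.cls = (c k).1.cls := (π⁻¹).2
    refine ⟨J.permute (τ := π.1.symm) hπ, funext fun l => ?_⟩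
    apply eq_of_heq
    refine (cast_heq _ _).trans ((cast_heq _ _).trans ?_)
    rw [Equiv.symm_apply_apply]

variable (B)

/-- Reindexing the labels of `c` by `π` turns the pairing with `τ` into the pairing with `τ * π`:
averaged states over diffeomorphic graphs with equal labels coincide. -/
theorem summand_eq {c c' : Fin n → GraphN C 1} (f : B.Labels c → ℂ) (f' : B.Labels c' → ℂ)
    {τ : Equiv.Perm (Fin n)} (hτ : ∀ l, (c' (τ l)).1.cls = (c l).1.cls) (π : partitionPerms c)
    (I : B.Labels c) (I' : B.Labels c') :
    B.summand f f' hτ π I I' = conj (f (I.permute π.2)) * f' I' *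
      inner ℂ (B.tensor c (I.permute π.2) 1) (B.tensor c' I' (τ * π)) := by
  rw [summand, inner_tensor, ← Equiv.prod_comp π.1]
  congr 1
  refine Finset.prod_congr rfl fun l _ => congrArg₂ _ ?_ ?_
  · exact (B.eta_cast (π.2 l) (I (π.1 l))).symm
  · exact B.eta_cast (hτ (π.1 l)) (I' (τ (π.1 l)))

/-! ### Inner products of symmetrised states -/

variable {c c' : Fin n → GraphN C 1} {f : B.Labels c → ℂ} {f' : B.Labels c' → ℂ}

variable {B} in
theorem IsCoefficients.summable_summand (hf' : B.IsCoefficients c' f')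
    {τ : Equiv.Perm (Fin n)} (hτ : ∀ l, (c' (τ l)).1.cls = (c l).1.cls) (π : partitionPerms c)
    (I : B.Labels c) : Summable fun I' => B.summand f f' hτ π I I' := by
  simp only [summand_eq, mul_assoc]
  exact (summable_mul_inner_right (hf' (τ * π)) _).mul_left _

variable {B} in
theorem IsCoefficients.tsum_summand (hf' : B.IsCoefficients c' f')
    {τ : Equiv.Perm (Fin n)} (hτ : ∀ l, (c' (τ l)).1.cls = (c l).1.cls) (π : partitionPerms c)
    (I : B.Labels c) :
    ∑' I', B.summand f f' hτ π I I' = conj (f (I.permute π.2)) *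
      inner ℂ (B.tensor c (I.permute π.2) 1) (∑' I', f' I' • B.tensor c' I' (τ * π)) := by
  simp only [summand_eq]
  exact tsum_tsum_conj_mul_mul_inner (u := fun J => B.tensor c J 1) (a := f) (hf' (τ * π))
    (I.permute π.2)

variable {B} in
theorem IsCoefficients.summable_tsum_summand (hf : B.IsCoefficients c f)
    (hf' : B.IsCoefficients c' f') {τ : Equiv.Perm (Fin n)}
    (hτ : ∀ l, (c' (τ l)).1.cls = (c l).1.cls) (π : partitionPerms c) :
    Summable fun I => ∑' I', B.summand f f' hτ π I I' := by
  simp only [hf'.tsum_summand hτ π]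
  exact (summable_conj_mul_inner_left (hf 1) _).comp_injective (Labels.permute_bijective π).injective

variable {B} in
theorem IsCoefficients.tsum_tsum_summand (hf : B.IsCoefficients c f)
    (hf' : B.IsCoefficients c' f') {τ : Equiv.Perm (Fin n)}
    (hτ : ∀ l, (c' (τ l)).1.cls = (c l).1.cls) (π : partitionPerms c) :
    ∑' I, ∑' I', B.summand f f' hτ π I I' =
      inner ℂ (∑' I, f I • B.tensor c I 1) (∑' I', f' I' • B.tensor c' I' (τ * π)) := by
  simp only [hf'.tsum_summand hτ π]
  rw [inner_tsum_left (hf 1)]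
  exact (Equiv.ofBijective _ (Labels.permute_bijective π)).tsum_eq fun J => conj (f J) *
    inner ℂ (B.tensor c J 1) (∑' I', f' I' • B.tensor c' I' (τ * π))

/-- One of the two symmetrisations is redundant, as only the relative permutation matters. -/
theorem inner_state (hf : B.IsCoefficients c f) (hf' : B.IsCoefficients c' f') :
    inner ℂ (B.state c f hf) (B.state c' f' hf') = (n.factorial : ℂ)⁻¹ *
      ∑ ρ : Equiv.Perm (Fin n),
        inner ℂ (∑' I, f I • B.tensor c I 1) (∑' I', f' I' • B.tensor c' I' ρ) := by
  have key : ∀ σ ρ : Equiv.Perm (Fin n),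
      inner ℂ (∑' I, f I • B.tensor c I σ) (∑' I', f' I' • B.tensor c' I' (ρ * σ)) =
        inner ℂ (∑' I, f I • B.tensor c I 1) (∑' I', f' I' • B.tensor c' I' ρ) := by
    intro σ ρ
    rw [inner_tsum_tsum (hf σ) (hf' (ρ * σ)), inner_tsum_tsum (hf 1) (hf' ρ)]
    simp only [← B.inner_tensor_mul c c' _ _ 1 ρ σ, one_mul]
  -- The inner product of the symmetric Fock space is that of the full Fock space.
  change inner ℂ (B.state c f hf : FullFock (etaSpace C 1))
    (B.state c' f' hf' : FullFock (etaSpace C 1)) = _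
  rw [state, state, lp.inner_single_left, lp.single_apply_self,
    inner_smul_left, inner_smul_right, sum_inner]
  have hσ : ∀ σ : Equiv.Perm (Fin n),
      inner ℂ (∑' I, f I • B.tensor c I σ)
        (∑ ρ : Equiv.Perm (Fin n), ∑' I', f' I' • B.tensor c' I' ρ) =
      ∑ ρ : Equiv.Perm (Fin n),
        inner ℂ (∑' I, f I • B.tensor c I 1) (∑' I', f' I' • B.tensor c' I' ρ) := by
    intro σ
    rw [inner_sum, ← Equiv.sum_comp (Equiv.mulRight σ)]
    exact Finset.sum_congr rfl fun ρ _ => key σ ρ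
  simp only [hσ, Finset.sum_const, Finset.card_univ, Fintype.card_perm, Fintype.card_fin,
    nsmul_eq_mul, map_inv₀, Complex.conj_natCast]
  have : (n.factorial : ℂ) ≠ 0 := Nat.cast_ne_zero.2 n.factorial_ne_zero
  field_simp

theorem inner_state_of_ne {n n' : ℕ} (h : n ≠ n') {c : Fin n → GraphN C 1}
    {c' : Fin n' → GraphN C 1} {f : B.Labels c → ℂ} {f' : B.Labels c' → ℂ}
    (hf : B.IsCoefficients c f) (hf' : B.IsCoefficients c' f') :
    inner ℂ (B.state c f hf) (B.state c' f' hf') = 0 := by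
  change inner ℂ (B.state c f hf : FullFock (etaSpace C 1))
    (B.state c' f' hf' : FullFock (etaSpace C 1)) = _
  rw [state, state, lp.inner_single_left, lp.single_apply_ne _ _ _ h,
    inner_zero_right]

variable {B} in
theorem IsCoefficients.inner_tsum_eq_zero (hf : B.IsCoefficients c f)
    (hf' : B.IsCoefficients c' f') {ρ : Equiv.Perm (Fin n)}
    (hρ : ¬ ∀ l, (c' (ρ l)).1.cls = (c l).1.cls) :
    inner ℂ (∑' I, f I • B.tensor c I 1) (∑' I', f' I' • B.tensor c' I' ρ) = 0 := by
  rw [inner_tsum_tsum (hf 1) (hf' ρ)]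
  simp only [B.inner_tensor_eq_zero c c' _ _ hρ, mul_zero, tsum_zero]

theorem inner_state_of_classes_ne (h : classes c ≠ classes c') (hf : B.IsCoefficients c f)
    (hf' : B.IsCoefficients c' f') :
    inner ℂ (B.state c f hf) (B.state c' f' hf') = 0 := by
  rw [inner_state, Finset.sum_eq_zero, mul_zero]
  refine fun ρ _ => hf.inner_tsum_eq_zero hf' fun hρ => h ?_
  calc classes c = (Finset.univ.val.map ρ).map fun k => (c' k).1.cls := by
        rw [Multiset.map_map]
        exact Multiset.map_congr rfl fun l _ => (hρ l).symm
    _ = classes c' := by rw [Multiset.map_univ_val_equiv, classes]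

/-- The permutations which match the classes of `c` with those of `c'` form the coset
`τ * partitionPerms c`, and only these contribute. -/
theorem inner_state_eq_sum (hf : B.IsCoefficients c f) (hf' : B.IsCoefficients c' f')
    {τ : Equiv.Perm (Fin n)} (hτ : ∀ l, (c' (τ l)).1.cls = (c l).1.cls) :
    inner ℂ (B.state c f hf) (B.state c' f' hf') = (n.factorial : ℂ)⁻¹ *
      ∑ᶠ π : partitionPerms c, ∑' I, ∑' I', B.summand f f' hτ π I I' := by
  have := Fintype.ofFinite (partitionPerms c)
  rw [inner_state, finsum_eq_sum_of_fintype]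
  congr 1
  refine (Fintype.sum_of_injective (fun π : partitionPerms c => τ * π.1)
    (fun π π' h => Subtype.ext (mul_left_cancel h)) _ _ (fun ρ hρ => ?_)
    fun π => hf.tsum_tsum_summand hf' hτ π).symm
  refine hf.inner_tsum_eq_zero hf' fun h => hρ ⟨⟨τ⁻¹ * ρ, fun l => ?_⟩, mul_inv_cancel_left _ _⟩
  rw [← hτ, ← h l, ← Equiv.Perm.mul_apply, mul_inv_cancel_left]

end SpinNetworkBases

end LQG

theorem mainTheorem5 (C : LQG.SmoothCategory) (B : LQG.SpinNetworkBases C) (n n' : ℕ)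
    (c : Fin n → LQG.GraphN C 1) (c' : Fin n' → LQG.GraphN C 1)
    (f : B.Labels c → ℂ) (hf : B.IsCoefficients c f)
    (f' : B.Labels c' → ℂ) (hf' : B.IsCoefficients c' f') :
    (n ≠ n' ∨ LQG.classes c ≠ LQG.classes c' →
      inner ℂ (B.state c f hf) (B.state c' f' hf') = 0) ∧
    (n = n' ∧ LQG.classes c = LQG.classes c' →
      (∃ τ : Fin n ≃ Fin n', ∀ l, (c' (τ l)).1.cls = (c l).1.cls) ∧
      ∀ (τ : Fin n ≃ Fin n') (hτ : ∀ l, (c' (τ l)).1.cls = (c l).1.cls),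
        (∀ π : LQG.partitionPerms c,
          (∀ I, Summable fun I' => B.summand f f' hτ π I I') ∧
          Summable fun I => ∑' I', B.summand f f' hτ π I I') ∧
        inner ℂ (B.state c f hf) (B.state c' f' hf') =
          (Nat.card (LQG.partitionPerms c) : ℂ)⁻¹ * ∑ᶠ π : LQG.partitionPerms c,
            (Nat.card (LQG.partitionPerms c) : ℂ) / (Nat.card (Equiv.Perm (Fin n)) : ℂ) *
              ∑' I, ∑' I', B.summand f f' hτ π I I') := by
  refine ⟨fun h => ?_, ?_⟩
  · by_cases hn : n = n'
    · subst hn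
      exact B.inner_state_of_classes_ne (h.resolve_left (not_not.2 rfl)) hf hf'
    · exact B.inner_state_of_ne hn hf hf'
  · rintro ⟨rfl, h⟩
    refine ⟨LQG.exists_equiv_of_map_univ_eq h, fun τ hτ => ⟨fun π =>
      ⟨hf'.summable_summand hτ π, hf.summable_tsum_summand hf' hτ π⟩, ?_⟩⟩
    have hc : (Nat.card (LQG.partitionPerms c) : ℂ) ≠ 0 := Nat.cast_ne_zero.2 Nat.card_pos.ne'
    rw [B.inner_state_eq_sum hf hf' hτ, Nat.card_perm, Nat.card_eq_fintype_card (α := Fin n),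
      Fintype.card_fin, ← mul_finsum, ← mul_assoc]
    congr 1
    field_simp
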